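/- Let $\Bbbk$ be an algebraically closed field of characteristic $0$ and let $p\ge 1$ be an integer. Let $Y_p(\mathfrak{gl}_2)$ be the Yangian of level $p$, i.e. the unital associative $\Bbbk$-algebra with generators $t_{ij}^{(r)}$ ($i,j\in\{1,2\}$, $1\le r\le p$) and defining relations $$[t^{(r)}_{ij},t^{(s)}_{mn}]=\sum_{a=1}^{\min(r,s)}\bigl(t^{(a-1)}_{mj}t^{(r+s-a)}_{in}-t^{(r+s-a)}_{mj}t^{(a-1)}_{in}\bigr),\qquad i,j,m,n\in\{1,2\},\ 1\le r,s\le p,$$ where $t^{(0)}_{ij}=\delta_{ij}$ and $t^{(r)}_{ij}=0$ for $r>p$. Put $$T_{ij}(u)=\delta_{ij}u^p+\sum_{r=1}^p t_{ij}^{(r)}u^{p-r},\qquad D(u)=T_{11}(u)\,T_{22}(u-1)-T_{21}(u)\,T_{12}(u-1),$$ polynomials in a central variable $u$ with coefficients in $Y_p(\mathfrak{gl}_2)$, and let $\Gamma$ be the subalgebra of $Y_p(\mathfrak{gl}_2)$ generated by the coefficients of $D(u)$ and by $t_{22}^{(1)},\dots,t_{22}^{(p)}$. Then $\Gamma$ is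 a Harish-Chandra subalgebra of $Y_p(\mathfrak{gl}_2)$: it is commutative, and for every $a\in Y_p(\mathfrak{gl}_2)$ the $\Gamma$-bimodule $\Gamma a\Gamma$ (the span of all products $gah$ with $g,h\in\Gamma$) is finitely generated both as a left and as a right $\Gamma$-module. -/

import Mathlib

open scoped Polynomial

section HarishChandraSubalgebra

/-- The bimodule `Γ a Γ` inside `U`: the span of all products `g * a * h` with `g, h ∈ Γ`. -/
def bimod {k U : Type*} [CommRing k] [Ring U] [Algebra k U] (Γ : Subalgebra k U) (a : U) :
    Submodule k U :=
  Submodule.span k {x : U | ∃ g ∈ Γ, ∃ h ∈ Γ, x = g * a * h}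

/-- `Γ a Γ` is stable under left multiplication by `Γ`. -/
theorem mul_mem_bimod {k U : Type*} [CommRing k] [Ring U] [Algebra k U] (Γ : Subalgebra k U)
    (a : U) {c x : U} (hc : c ∈ Γ) (hx : x ∈ bimod Γ a) : c * x ∈ bimod Γ a := by
  refine Submodule.span_induction (p := fun x _ => c * x ∈ bimod Γ a) ?_ ?_ ?_ ?_ hx
  · rintro x ⟨g, hg, h, hh, rfl⟩
    exact Submodule.subset_span ⟨c * g, Γ.mul_mem hc hg, h, hh, by simp only [mul_assoc]⟩
  · simp
  · intro x y _ _ hx hy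
    rw [mul_add]
    exact Submodule.add_mem _ hx hy
  · intro r x _ hx
    rw [mul_smul_comm]
    exact Submodule.smul_mem _ r hx

/-- `Γ a Γ` is stable under right multiplication by `Γ`. -/
theorem bimod_mul_mem {k U : Type*} [CommRing k] [Ring U] [Algebra k U] (Γ : Subalgebra k U)
    (a : U) {c x : U} (hc : c ∈ Γ) (hx : x ∈ bimod Γ a) : x * c ∈ bimod Γ a := by
  refine Submodule.span_induction (p := fun x _ => x * c ∈ bimod Γ a) ?_ ?_ ?_ ?_ hx
  · rintro x ⟨g, hg, h, hh, rfl⟩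
    exact Submodule.subset_span ⟨g, hg, h * c, Γ.mul_mem hh hc, by simp only [mul_assoc]⟩
  · simp
  · intro x y _ _ hx hy
    rw [add_mul]
    exact Submodule.add_mem _ hx hy
  · intro r x _ hx
    rw [smul_mul_assoc]
    exact Submodule.smul_mem _ r hx

/-- `Γ a Γ` as a left `Γ`-module (a left `Γ`-submodule of `U`). -/
def bimodLeft {k U : Type*} [CommRing k] [Ring U] [Algebra k U] (Γ : Subalgebra k U) (a : U) :
    Submodule Γ U where
  carrier := bimod Γ a
  add_mem' := fun hx hy => (bimod Γ a).add_mem hx hy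
  zero_mem' := (bimod Γ a).zero_mem
  smul_mem' := fun c _ hx => mul_mem_bimod Γ a c.2 hx

/-- `Γ a Γ` as a right `Γ`-module: a right `Γ`-submodule of `U`, that is, a submodule over the
opposite subalgebra `Γ.op` of `Uᵐᵒᵖ`, which acts on `U` by right multiplication. -/
def bimodRight {k U : Type*} [CommRing k] [Ring U] [Algebra k U] (Γ : Subalgebra k U) (a : U) :
    Submodule Γ.op U where
  carrier := bimod Γ a
  add_mem' := fun hx hy => (bimod Γ a).add_mem hx hy
  zero_mem' := (bimod Γ a).zero_mem
  smul_mem' := fun c _ hx => bimod_mul_mem Γ a (Subalgebra.mem_op.mp c.2) hx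

/-- A Harish-Chandra subalgebra of `U`: a commutative subalgebra `Γ` such that for every `a ∈ U`
the bimodule `Γ a Γ` is finitely generated both as a left and as a right `Γ`-module. -/
structure IsHarishChandraSubalgebra {k U : Type*} [CommRing k] [Ring U] [Algebra k U]
    (Γ : Subalgebra k U) : Prop where
  comm : ∀ x ∈ Γ, ∀ y ∈ Γ, x * y = y * x
  fg_left : ∀ a : U, (bimodLeft Γ a).FG
  fg_right : ∀ a : U, (bimodRight Γ a).FG

end HarishChandraSubalgebra

namespace LevelYangian

noncomputable section

/-- The element `t_{ij}^{(r)}` of the free algebra on the generators `t_{ij}^{(1)}, …, t_{ij}^{(p)}`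
(`i, j = 1, 2`), with the conventions `t_{ij}^{(0)} = δ_{ij}` and `t_{ij}^{(r)} = 0` for `r > p`.
The matrix indices `1, 2` are the elements `0, 1` of `Fin 2`, and the generator `t_{ij}^{(r)}`
with `1 ≤ r ≤ p` has the label `(i, j, r - 1)`. -/
def freeGen (k : Type*) [Field k] (p : ℕ) (i j : Fin 2) (r : ℕ) :
    FreeAlgebra k (Fin 2 × Fin 2 × Fin p) :=
  if r = 0 then (if i = j then 1 else 0)
  else if h : r - 1 < p then FreeAlgebra.ι k (i, j, ⟨r - 1, h⟩)
  else 0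

/-- The defining relations of the level `p` Yangian of `gl_2`:
`[t_{ij}^{(r)}, t_{mn}^{(s)}]
  = ∑_{a=1}^{min(r,s)} (t_{mj}^{(a-1)} t_{in}^{(r+s-a)} - t_{mj}^{(r+s-a)} t_{in}^{(a-1)})`. -/
inductive Rel (k : Type*) [Field k] (p : ℕ) :
    FreeAlgebra k (Fin 2 × Fin 2 × Fin p) → FreeAlgebra k (Fin 2 × Fin 2 × Fin p) → Prop
  | comm (i j m n : Fin 2) (r s : ℕ) (hr : r ∈ Finset.Icc 1 p) (hs : s ∈ Finset.Icc 1 p) :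
      Rel k p
        (freeGen k p i j r * freeGen k p m n s - freeGen k p m n s * freeGen k p i j r)
        (∑ a ∈ Finset.Icc 1 (min r s),
          (freeGen k p m j (a - 1) * freeGen k p i n (r + s - a)
            - freeGen k p m j (r + s - a) * freeGen k p i n (a - 1)))

end

/-- The level `p` Yangian `Y_p(gl_2)` over `k`. -/
def Yangian (k : Type*) [Field k] (p : ℕ) : Type _ := RingQuot (Rel k p)

noncomputable section

instance (k : Type*) [Field k] (p : ℕ) : Ring (Yangian k p) :=
  inferInstanceAs (Ring (RingQuot (Rel k p)))

instance (k : Type*) [Field k] (p : ℕ) : Algebra k (Yangian k p) :=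
  inferInstanceAs (Algebra k (RingQuot (Rel k p)))

/-- The canonical projection from the free algebra onto `Y_p(gl_2)`. -/
def proj (k : Type*) [Field k] (p : ℕ) :
    FreeAlgebra k (Fin 2 × Fin 2 × Fin p) →ₐ[k] Yangian k p :=
  RingQuot.mkAlgHom k (Rel k p)

/-- The element `t_{ij}^{(r)}` of `Y_p(gl_2)`, with `t_{ij}^{(0)} = δ_{ij}` and
`t_{ij}^{(r)} = 0` for `r > p`. -/
def t (k : Type*) [Field k] (p : ℕ) (i j : Fin 2) (r : ℕ) : Yangian k p :=
  proj k p (freeGen k p i j r)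

/-- `T_{ij}(u) = δ_{ij} u^p + ∑_{r=1}^p t_{ij}^{(r)} u^{p-r}`, a polynomial in the central
variable `u = X` with coefficients in `Y_p(gl_2)`. -/
def T (k : Type*) [Field k] (p : ℕ) (i j : Fin 2) : (Yangian k p)[X] :=
  (if i = j then Polynomial.X ^ p else 0)
    + ∑ r ∈ Finset.Icc 1 p, Polynomial.C (t k p i j r) * Polynomial.X ^ (p - r)

/-- The polynomial `T_{ij}(u - 1)`. -/
def Tshift (k : Type*) [Field k] (p : ℕ) (i j : Fin 2) : (Yangian k p)[X] :=
  (T k p i j).comp (Polynomial.X - 1)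

/-- The quantum determinant `D(u) = T_{11}(u) T_{22}(u-1) - T_{21}(u) T_{12}(u-1)`. -/
def qdet (k : Type*) [Field k] (p : ℕ) : (Yangian k p)[X] :=
  T k p 0 0 * Tshift k p 1 1 - T k p 1 0 * Tshift k p 0 1

/-- The subalgebra `Γ` of `Y_p(gl_2)` generated by the coefficients of `D(u)` and by the elements
`t_{22}^{(1)}, …, t_{22}^{(p)}`. -/
def Gam (k : Type*) [Field k] (p : ℕ) : Subalgebra k (Yangian k p) :=
  Algebra.adjoin k
    (Set.range (fun n : ℕ => (qdet k p).coeff n) ∪ {x | ∃ r ∈ Finset.Icc 1 p, x = t k p 1 1 r})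

end

end LevelYangian

/-!
The proof has two independent parts.

*Structure of `Y_p(gl_2)`.* The defining relations amount to the RTT relation
`(x - y) [T_{ij}(x), T_{mn}(y)] = T_{mj}(x) T_{in}(y) - T_{mj}(y) T_{in}(x)` for all scalars `x, y`
(`Tval_comm`); since `k` is infinite, passing to scalar values of `u` loses no information. Solving
this relation for `T_{ij}(x) T_{mn}(y)` moves `T(y)` to the left of the two factors in each term of
`D(x)`, and the relations between `T(x)` and `T(x - 1)` then show that `D(x)` commutes with `T(y)`
for all but finitely many `y`. So the coefficients of `D(u)` are central (`qdet_coeff_comm`). With the commutativity of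
the `t_{22}^{(r)}`, this makes `Γ` commutative and finitely generated, hence Noetherian. The algebra
is generated by `Γ` and the off-diagonal elements `t_{12}^{(r)}`, `t_{21}^{(r)}`: the `t_{11}^{(r)}`
are recovered from `T_{11}(u) T_{22}(u-1) = D(u) + T_{21}(u) T_{12}(u-1)`, because `T_{22}(u-1)` is
monic (`adjoin_gamGenerators_union_offDiag`).

*Finite generation.* Over a Noetherian `Γ`, the elements `a` with `Γ a Γ` finitely generated on the
left form a subalgebra containing `Γ`, so it suffices to consider off-diagonal elements. Their
commutators with the `t_{22}^{(s)}` are combinations of products of a single off-diagonal element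
and a single `t_{22}^{(a)}`, so that the left `Γ`-span of the finitely many off-diagonal elements is
already a sub-bimodule (`offDiag_mul_mem`). The right-hand statement is the left-hand one in the
opposite algebra (`IsHarishChandraSubalgebra.of_adjoin`).
-/

/-! ### A criterion for Harish-Chandra subalgebras -/

section Criterion

variable {k U : Type*} [CommRing k] [Ring U] [Algebra k U]

/-- To bound `Γ a Γ` by a left `Γ`-submodule, it suffices to look at the products `a * h`. -/
theorem bimodLeft_le {Γ : Subalgebra k U} {a : U} {N : Submodule Γ U}
    (h : ∀ c ∈ Γ, a * c ∈ N) : bimodLeft Γ a ≤ N := by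
  have key : bimod Γ a ≤ N.restrictScalars k := by
    refine Submodule.span_le.2 ?_
    rintro x ⟨g, hg, c, hc, rfl⟩
    rw [mul_assoc]
    exact N.smul_mem ⟨g, hg⟩ (h c hc)
  exact fun x hx => key hx

theorem self_mem_bimod (Γ : Subalgebra k U) (a : U) : a ∈ bimod Γ a :=
  Submodule.subset_span ⟨1, Γ.one_mem, 1, Γ.one_mem, by simp⟩

open scoped IsMulCommutative in
/-- A finitely generated commutative subalgebra is a Noetherian ring. -/
theorem isNoetherianRing_adjoin {k U : Type*} [Field k] [Ring U] [Algebra k U] {s : Set U}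
    (hs : s.Finite) (hcomm : ∀ x ∈ s, ∀ y ∈ s, x * y = y * x) :
    IsNoetherianRing (Algebra.adjoin k s) := by
  have := Algebra.isMulCommutative_adjoin k hcomm
  have : Algebra.FiniteType k (Algebra.adjoin k s) :=
    (Subalgebra.fg_iff_finiteType _).1 ⟨hs.toFinset, by simp⟩
  exact Algebra.FiniteType.isNoetherianRing k (Algebra.adjoin k s)

/-- Over a left Noetherian `Γ`, the left finite generation of `Γ a Γ` is inherited by products. -/
theorem bimodLeft_mul_fg {Γ : Subalgebra k U} [IsNoetherianRing Γ] {a b : U}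
    (ha : (bimodLeft Γ a).FG) (hb : (bimodLeft Γ b).FG) : (bimodLeft Γ (a * b)).FG := by
  obtain ⟨A, hA⟩ := ha
  obtain ⟨B, hB⟩ := hb
  classical
  have hN : (Submodule.span Γ ((Finset.image₂ (· * ·) A B : Finset U) : Set U)).FG := ⟨_, rfl⟩
  have := isNoetherian_of_fg_of_noetherian _ hN
  refine Submodule.FG.of_le hN (bimodLeft_le fun c hc => ?_)
  -- `Γ a Γ * Γ b Γ` lies in the left `Γ`-span of the products of elements of `A` and `B`, since a
  -- coefficient in front of an element of `B` is absorbed into `Γ a Γ`.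
  have h1 : ∀ x ∈ bimodLeft Γ a, ∀ y ∈ B,
      x * y ∈ Submodule.span Γ ((Finset.image₂ (· * ·) A B : Finset U) : Set U) := by
    intro x hx y hy
    rw [← hA] at hx
    refine Submodule.span_induction (fun x hx => ?_) ?_ (fun x z _ _ hx hz => ?_)
      (fun g x _ hx => ?_) hx
    · exact Submodule.subset_span (Finset.mem_coe.2 (Finset.mem_image₂_of_mem hx hy))
    · simp
    · rw [add_mul]
      exact add_mem hx hz
    · rw [smul_mul_assoc]
      exact Submodule.smul_mem _ g hx
  have h2 : ∀ y ∈ bimodLeft Γ b, ∀ x ∈ bimodLeft Γ a,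
      x * y ∈ Submodule.span Γ ((Finset.image₂ (· * ·) A B : Finset U) : Set U) := by
    intro y hy
    rw [← hB] at hy
    refine Submodule.span_induction (fun y hy x hx => h1 x hx y hy) ?_
      (fun y z _ _ hy hz x hx => ?_) (fun g y _ hy x hx => ?_) hy
    · simp
    · rw [mul_add]
      exact add_mem (hy x hx) (hz x hx)
    · have : x * g • y = x * g * y := by
        rw [Subalgebra.smul_def, smul_eq_mul, mul_assoc]
      rw [this]
      exact hy _ (bimod_mul_mem Γ a g.2 hx)
  rw [mul_assoc]
  exact h2 _ (bimod_mul_mem Γ b hc (self_mem_bimod Γ b)) _ (self_mem_bimod Γ a)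

theorem bimodLeft_add_fg {Γ : Subalgebra k U} [IsNoetherianRing Γ] {a b : U}
    (ha : (bimodLeft Γ a).FG) (hb : (bimodLeft Γ b).FG) : (bimodLeft Γ (a + b)).FG := by
  have hN := ha.sup hb
  have := isNoetherian_of_fg_of_noetherian _ hN
  refine Submodule.FG.of_le hN (bimodLeft_le fun c hc => ?_)
  rw [add_mul]
  exact Submodule.add_mem_sup (bimod_mul_mem Γ a hc (self_mem_bimod Γ a))
    (bimod_mul_mem Γ b hc (self_mem_bimod Γ b))

theorem bimodLeft_fg_of_mem {Γ : Subalgebra k U} [IsNoetherianRing Γ] {a : U} (ha : a ∈ Γ) :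
    (bimodLeft Γ a).FG := by
  have hN : (Submodule.span Γ ({1} : Set U)).FG := Submodule.fg_span_singleton 1
  have := isNoetherian_of_fg_of_noetherian _ hN
  refine Submodule.FG.of_le hN (bimodLeft_le fun c hc => ?_)
  refine Submodule.mem_span_singleton.2 ⟨⟨a * c, Γ.mul_mem ha hc⟩, ?_⟩
  simp [Subalgebra.smul_def]

/-- If `U` is generated by `Γ` and a set `G`, then left finite generation of `Γ a Γ` need only be
checked for `a ∈ G`. -/
theorem bimodLeft_fg_of_adjoin {Γ : Subalgebra k U} [IsNoetherianRing Γ] {G : Set U}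
    (hG : ∀ g ∈ G, (bimodLeft Γ g).FG) {a : U} (ha : a ∈ Algebra.adjoin k (Γ ∪ G : Set U)) :
    (bimodLeft Γ a).FG := by
  refine Algebra.adjoin_induction (fun x hx => ?_) (fun r => ?_)
    (fun x y _ _ hx hy => bimodLeft_add_fg hx hy) (fun x y _ _ hx hy => bimodLeft_mul_fg hx hy) ha
  · rcases hx with hx | hx
    · exact bimodLeft_fg_of_mem hx
    · exact hG x hx
  · exact bimodLeft_fg_of_mem (Γ.algebraMap_mem r)

/-- If the left `Γ`-span of a finite set `W` is stable under right multiplication by generators of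
`Γ`, then it is a sub-bimodule, hence contains `Γ w Γ` for every `w ∈ W`. -/
theorem bimodLeft_fg_of_stable {s : Set U} [IsNoetherianRing (Algebra.adjoin k s)] {W : Set U}
    (hW : W.Finite)
    (h : ∀ w ∈ W, ∀ c ∈ s, w * c ∈ Submodule.span (Algebra.adjoin k s) W) {w : U} (hw : w ∈ W) :
    (bimodLeft (Algebra.adjoin k s) w).FG := by
  have hN := Submodule.fg_span (R := Algebra.adjoin k s) hW
  have := isNoetherian_of_fg_of_noetherian _ hN
  refine Submodule.FG.of_le hN (bimodLeft_le fun c hc => ?_)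
  have key : ∀ x ∈ Submodule.span (Algebra.adjoin k s) W,
      x * c ∈ Submodule.span (Algebra.adjoin k s) W := by
    refine Algebra.adjoin_induction (fun c hc x hx => ?_) (fun r x hx => ?_)
      (fun c d _ _ hc hd x hx => ?_) (fun c d _ _ hc hd x hx => ?_) hc
    · refine Submodule.span_induction (fun x hx => h x hx c hc) ?_ (fun x z _ _ hx hz => ?_)
        (fun g x _ hx => ?_) hx
      · simp
      · rw [add_mul]
        exact add_mem hx hz
      · rw [smul_mul_assoc]
        exact Submodule.smul_mem _ g hx
    · rw [← Algebra.commutes, ← Algebra.smul_def]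
      exact ((Submodule.span (Algebra.adjoin k s) W).restrictScalars k).smul_mem r hx
    · rw [mul_add]
      exact add_mem (hc x hx) (hd x hx)
    · rw [← mul_assoc]
      exact hd _ (hc x hx)
  exact key w (Submodule.subset_span hw)

theorem op_mem_bimod {Γ : Subalgebra k U} {a x : U} :
    MulOpposite.op x ∈ bimod Γ.op (MulOpposite.op a) ↔ x ∈ bimod Γ a := by
  have : bimod Γ.op (MulOpposite.op a) =
      (bimod Γ a).map (MulOpposite.opLinearEquiv k : U ≃ₗ[k] Uᵐᵒᵖ).toLinearMap := by
    rw [bimod, bimod, Submodule.map_span]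
    congr 1
    ext y
    constructor
    · rintro ⟨g, hg, h, hh, rfl⟩
      exact ⟨h.unop * a * g.unop, ⟨h.unop, hh, g.unop, hg, rfl⟩, by simp [mul_assoc]⟩
    · rintro ⟨_, ⟨g, hg, h, hh, rfl⟩, rfl⟩
      exact ⟨MulOpposite.op h, hh, MulOpposite.op g, hg, by simp [mul_assoc]⟩
  rw [this]
  exact ⟨fun ⟨z, hz, hzx⟩ => MulOpposite.op_injective hzx ▸ hz, fun hx => ⟨x, hx, rfl⟩⟩

/-- Passing to the opposite algebra exchanges the two module structures on `Γ a Γ`. -/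
theorem bimodRight_fg_of_op {Γ : Subalgebra k U} {a : U}
    (h : (bimodLeft Γ.op (MulOpposite.op a)).FG) : (bimodRight Γ a).FG := by
  let f : Uᵐᵒᵖ →ₗ[Γ.op] U :=
    { toFun := MulOpposite.unop
      map_add' := fun _ _ => rfl
      map_smul' := fun _ _ => rfl }
  convert h.map f
  ext x
  exact ⟨fun hx => ⟨MulOpposite.op x, op_mem_bimod.2 hx, rfl⟩,
    fun ⟨y, hy, hyx⟩ => hyx ▸ (op_mem_bimod (x := y.unop)).1 hy⟩

theorem op_mem_span {Γ : Subalgebra k U} {G : Set U} {x : U}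
    (hx : x ∈ Submodule.span Γ.op G) :
    MulOpposite.op x ∈ Submodule.span Γ.op (MulOpposite.unop ⁻¹' G : Set Uᵐᵒᵖ) := by
  refine Submodule.span_induction (fun x hx => Submodule.subset_span hx) (zero_mem _)
    (fun x y _ _ hx hy => add_mem hx hy) (fun c x _ hx => Submodule.smul_mem _ c hx) hx

/-- Suppose a commutative subalgebra `Γ` with finite generating set `s`, together with a finite set
`G`, generates `U`. If right multiplication by `s` maps `G` into the left `Γ`-span of `G`, and left
multiplication by `s` maps `G` into the right `Γ`-span of `G`, then `Γ` is a Harish-Chandra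
subalgebra. -/
theorem IsHarishChandraSubalgebra.of_adjoin {k U : Type*} [Field k] [Ring U] [Algebra k U]
    {s G : Set U} (hs : s.Finite) (hcomm : ∀ x ∈ s, ∀ y ∈ s, x * y = y * x) (hG : G.Finite)
    (htop : Algebra.adjoin k (s ∪ G) = ⊤)
    (hl : ∀ w ∈ G, ∀ c ∈ s, w * c ∈ Submodule.span (Algebra.adjoin k s) G)
    (hr : ∀ w ∈ G, ∀ c ∈ s, c * w ∈ Submodule.span (Algebra.adjoin k s).op G) :
    IsHarishChandraSubalgebra (Algebra.adjoin k s) where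
  comm x hx y hy := by
    have := Algebra.isMulCommutative_adjoin k hcomm
    exact congrArg Subtype.val
      (mul_comm' (⟨x, hx⟩ : Algebra.adjoin k s) (⟨y, hy⟩ : Algebra.adjoin k s))
  fg_left a := by
    have := isNoetherianRing_adjoin (k := k) hs hcomm
    refine bimodLeft_fg_of_adjoin (G := G) (fun g hg => bimodLeft_fg_of_stable hG hl hg) ?_
    refine Algebra.adjoin_mono (Set.union_subset_union_left G Algebra.subset_adjoin) ?_
    rw [htop]
    exact Algebra.mem_top
  fg_right a := by
    refine bimodRight_fg_of_op ?_
    have hl' : ∀ w ∈ (MulOpposite.unop ⁻¹' G : Set Uᵐᵒᵖ),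
        ∀ c ∈ (MulOpposite.unop ⁻¹' s : Set Uᵐᵒᵖ), w * c ∈
          Submodule.span (Algebra.adjoin k s).op (MulOpposite.unop ⁻¹' G : Set Uᵐᵒᵖ) :=
      fun w hw c hc => op_mem_span (hr _ hw _ hc)
    rw [Subalgebra.op_adjoin] at hl' ⊢
    have hs' : (MulOpposite.unop ⁻¹' s : Set Uᵐᵒᵖ).Finite :=
      hs.preimage MulOpposite.unop_injective.injOn
    have := isNoetherianRing_adjoin (k := k) hs' fun x hx y hy =>
      MulOpposite.unop_injective (hcomm _ hy _ hx)
    refine bimodLeft_fg_of_adjoin (G := MulOpposite.unop ⁻¹' G)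
      (fun g hg => bimodLeft_fg_of_stable (hG.preimage MulOpposite.unop_injective.injOn) hl' hg) ?_
    refine Algebra.adjoin_mono (Set.union_subset_union_left _ Algebra.subset_adjoin) ?_
    rw [← Set.preimage_union, ← Subalgebra.op_adjoin, htop, Subalgebra.op_top]
    exact Algebra.mem_top

end Criterion

/-! ### Polynomials over noncommutative rings -/

section Polynomials

/-- Polynomial identities in a central variable can be checked on scalars: a `V`-valued polynomial
function vanishing outside a finite set of scalars has vanishing coefficients. -/
theorem coeff_eq_zero_of_eval {k V : Type*} [Field k] [Infinite k] [AddCommGroup V] [Module k V]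
    {F : Set k} (hF : F.Finite) {n : ℕ} {a : ℕ → V}
    (h : ∀ x ∉ F, ∑ i ∈ Finset.range n, x ^ i • a i = 0) {i : ℕ} (hi : i < n) : a i = 0 := by
  rw [← Module.forall_dual_apply_eq_zero_iff k]
  intro φ
  let q : k[X] := ∑ i ∈ Finset.range n, Polynomial.monomial i (φ (a i))
  have hq : q = 0 := by
    refine Polynomial.eq_zero_of_infinite_isRoot q (hF.infinite_compl.mono fun x hx => ?_)
    have := congrArg φ (h x hx)
    simp only [map_sum, map_smul, smul_eq_mul, map_zero] at this
    simp only [Set.mem_ofPred_eq, Polynomial.IsRoot.def, q, Polynomial.eval_finsetSum,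
      Polynomial.eval_monomial]
    simpa only [mul_comm] using this
  have := congrArg (fun q => q.coeff i) hq
  simpa [q, Polynomial.finsetSum_coeff, Polynomial.coeff_monomial, hi] using this

/-- If `f * g` and the monic polynomial `g` have coefficients in a subring, then so does `f`. -/
theorem coeff_mem_of_mul_monic {U : Type*} [Ring U] (S : Subring U) {g : U[X]} (hg : g.Monic)
    (hgS : g ∈ Polynomial.liftsRing S.subtype) (f : U[X])
    (hf : f * g ∈ Polynomial.liftsRing S.subtype) : f ∈ Polynomial.liftsRing S.subtype := by
  induction hn : f.support.card using Nat.strong_induction_on generalizing f with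
  | _ n ih =>
    by_cases h0 : f = 0
    · rw [h0]
      exact zero_mem _
    have hlead : f.leadingCoeff ∈ Set.range S.subtype := by
      rw [← Polynomial.leadingCoeff_mul_monic hg]
      rw [← Polynomial.lifts_iff_liftsRing, Polynomial.lifts_iff_coeff_lifts] at hf
      exact hf _
    have hterm : Polynomial.monomial f.natDegree f.leadingCoeff ∈
        Polynomial.liftsRing S.subtype := by
      rw [← Polynomial.lifts_iff_liftsRing]
      exact Polynomial.monomial_mem_lifts _ hlead
    rw [← f.eraseLead_add_monomial_natDegree_leadingCoeff] at hf ⊢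
    refine add_mem (ih _ (hn ▸ Polynomial.eraseLead_support_card_lt h0) _ ?_ rfl) hterm
    rw [add_mul] at hf
    exact (add_mem_cancel_right (mul_mem hterm hgS)).1 hf

end Polynomials

namespace LevelYangian

variable {k : Type*} [Field k] {p : ℕ}

/-! ### The RTT relation -/

theorem t_zero (i j : Fin 2) : t k p i j 0 = if i = j then 1 else 0 := by
  simp only [t, freeGen, if_true]
  split_ifs <;> simp

theorem t_eq_zero {r : ℕ} (hr : p < r) (i j : Fin 2) : t k p i j r = 0 := by
  simp [t, freeGen, show r ≠ 0 by lia, show ¬ r - 1 < p by lia]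

/-- The defining relations hold without restriction on the levels `r` and `s`. -/
theorem t_comm (i j m n : Fin 2) (r s : ℕ) :
    t k p i j r * t k p m n s - t k p m n s * t k p i j r =
      ∑ a ∈ Finset.Icc 1 (min r s), (t k p m j (a - 1) * t k p i n (r + s - a)
        - t k p m j (r + s - a) * t k p i n (a - 1)) := by
  by_cases h : r ∈ Finset.Icc 1 p ∧ s ∈ Finset.Icc 1 p
  · have := RingQuot.mkAlgHom_rel k (Rel.comm (k := k) (p := p) i j m n r s h.1 h.2)
    change proj k p _ = proj k p _ at this
    simpa only [t, map_sub, map_mul, map_sum] using this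
  simp only [Finset.mem_Icc] at h
  rcases Nat.eq_zero_or_pos r with rfl | hr
  · simp only [t_zero]
    split_ifs <;> simp
  rcases Nat.eq_zero_or_pos s with rfl | hs
  · simp only [t_zero]
    split_ifs <;> simp
  rw [Finset.sum_eq_zero]
  · by_cases hr' : p < r
    · simp [t_eq_zero hr']
    · simp [t_eq_zero (show p < s by lia)]
  · intro a ha
    rw [Finset.mem_Icc] at ha
    simp [t_eq_zero (show p < r + s - a by lia)]

/-- The defining relations in difference form: as the sum in `t_comm` depends on the levels only
through `r + s` and `min r s`, raising `r` or raising `s` gives sums that differ by at most one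
term. -/
theorem t_comm_succ (i j m n : Fin 2) (r s : ℕ) :
    (t k p i j (r + 1) * t k p m n s - t k p m n s * t k p i j (r + 1))
      - (t k p i j r * t k p m n (s + 1) - t k p m n (s + 1) * t k p i j r) =
      t k p m j r * t k p i n s - t k p m j s * t k p i n r := by
  rw [t_comm, t_comm, show r + (s + 1) = r + 1 + s by lia]
  rcases lt_trichotomy r s with h | rfl | h
  · rw [min_eq_left (show r + 1 ≤ s by lia), min_eq_left (show r ≤ s + 1 by lia),
      Finset.sum_Icc_succ_top (by lia), add_sub_cancel_left]
    simp
  · simp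
  · rw [min_eq_right (show s ≤ r + 1 by lia), min_eq_right (show s + 1 ≤ r by lia),
      Finset.sum_Icc_succ_top (by lia), show r + 1 + s - (s + 1) = r by lia]
    simp

variable (k p) in
/-- The value at a scalar `x` of the polynomial `T_{ij}(u)`. -/
noncomputable def Tval (x : k) (i j : Fin 2) : Yangian k p :=
  ∑ r ∈ Finset.range (p + 1), x ^ (p - r) • t k p i j r

/-- The values of `T_{ij}(u)` in ascending powers of the scalar. -/
theorem Tval_eq_reflect (x : k) (i j : Fin 2) :
    Tval k p x i j = ∑ r ∈ Finset.range (p + 1), x ^ r • t k p i j (p - r) := by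
  rw [Tval, ← Finset.sum_range_reflect]
  refine Finset.sum_congr rfl fun r hr => ?_
  rw [Finset.mem_range] at hr
  rw [show p + 1 - 1 - r = p - r by lia, show p - (p - r) = r by lia]

/-- A linear map killing almost all values of `T_{ij}(u)` kills its coefficients. -/
theorem map_t_eq_zero [Infinite k] {V : Type*} [AddCommGroup V] [Module k V]
    (f : Yangian k p →ₗ[k] V) {F : Set k} (hF : F.Finite) {i j : Fin 2}
    (h : ∀ x ∉ F, f (Tval k p x i j) = 0) (r : ℕ) : f (t k p i j r) = 0 := by
  by_cases hr : p < r
  · rw [t_eq_zero hr, map_zero]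
  · have := coeff_eq_zero_of_eval (n := p + 1) (a := fun r => f (t k p i j (p - r))) hF
      (fun x hx => by simpa only [Tval_eq_reflect, map_sum, map_smul] using h x hx)
      (show p - r < p + 1 by lia)
    simpa only [show p - (p - r) = r by lia] using this

/-- The defining relations in terms of the generating polynomials. -/
theorem Tval_comm (x y : k) (i j m n : Fin 2) :
    (x - y) • (Tval k p x i j * Tval k p y m n - Tval k p y m n * Tval k p x i j) =
      Tval k p x m j * Tval k p y i n - Tval k p y m j * Tval k p x i n := by
  set c : ℕ → ℕ → Yangian k p := fun r s =>
    t k p i j r * t k p m n s - t k p m n s * t k p i j r with hc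
  have hc0 : ∀ s, c 0 s = 0 := fun s => by simp only [hc, t_comm]; simp
  have hc0' : ∀ r, c r 0 = 0 := fun s => by simp only [hc, t_comm]; simp
  have hcp : ∀ s, c (p + 1) s = 0 := fun s => by
    simp [hc, t_eq_zero (show p < p + 1 by lia)]
  have hcp' : ∀ r, c r (p + 1) = 0 := fun s => by
    simp [hc, t_eq_zero (show p < p + 1 by lia)]
  have hmul : ∀ (x y : k) (i j m n : Fin 2), Tval k p x i j * Tval k p y m n =
      ∑ r ∈ Finset.range (p + 1), ∑ s ∈ Finset.range (p + 1),
        (x ^ (p - r) * y ^ (p - s)) • (t k p i j r * t k p m n s) := fun x y i j m n => by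
    simp only [Tval, Finset.sum_mul_sum, smul_mul_smul_comm]
  have hL : Tval k p x i j * Tval k p y m n - Tval k p y m n * Tval k p x i j =
      ∑ r ∈ Finset.range (p + 1), ∑ s ∈ Finset.range (p + 1),
        (x ^ (p - r) * y ^ (p - s)) • c r s := by
    rw [hmul, hmul, Finset.sum_comm (s := Finset.range (p + 1)) (t := Finset.range (p + 1))
      (f := fun s r => (y ^ (p - s) * x ^ (p - r)) • (t k p m n s * t k p i j r))]
    simp only [← Finset.sum_sub_distrib, hc, smul_sub, mul_comm (y ^ _)]
  -- The boundary terms vanish because `t^{(0)}` is a scalar and `t^{(p+1)} = 0`.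
  have shift : ∀ (z : k) (d : ℕ → Yangian k p), d 0 = 0 → d (p + 1) = 0 →
      ∑ r ∈ Finset.range (p + 1), (z * z ^ (p - r)) • d r =
        ∑ r ∈ Finset.range (p + 1), z ^ (p - r) • d (r + 1) := by
    intro z d h0 hp
    rw [Finset.sum_range_succ', Finset.sum_range_succ, h0, hp, smul_zero, smul_zero]
    congr 1
    refine Finset.sum_congr rfl fun r hr => ?_
    rw [Finset.mem_range] at hr
    rw [← pow_succ', show p - (r + 1) + 1 = p - r by lia]
  have hx : x • ∑ r ∈ Finset.range (p + 1), ∑ s ∈ Finset.range (p + 1),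
        (x ^ (p - r) * y ^ (p - s)) • c r s =
      ∑ r ∈ Finset.range (p + 1), ∑ s ∈ Finset.range (p + 1),
        (x ^ (p - r) * y ^ (p - s)) • c (r + 1) s := by
    have := shift x (fun r => ∑ s ∈ Finset.range (p + 1), y ^ (p - s) • c r s)
      (by simp [hc0]) (by simp [hcp])
    simpa only [Finset.smul_sum, smul_smul, mul_assoc] using this
  have hy : y • ∑ r ∈ Finset.range (p + 1), ∑ s ∈ Finset.range (p + 1),
        (x ^ (p - r) * y ^ (p - s)) • c r s =
      ∑ r ∈ Finset.range (p + 1), ∑ s ∈ Finset.range (p + 1),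
        (x ^ (p - r) * y ^ (p - s)) • c r (s + 1) := by
    rw [Finset.smul_sum]
    refine Finset.sum_congr rfl fun r _ => ?_
    have := congrArg (fun z => x ^ (p - r) • z) (shift y (c r) (hc0' r) (hcp' r))
    simpa only [Finset.smul_sum, smul_smul, mul_left_comm] using this
  rw [hL, sub_smul, hx, hy, hmul, hmul,
    Finset.sum_comm (s := Finset.range (p + 1)) (t := Finset.range (p + 1))
      (f := fun s r => (y ^ (p - s) * x ^ (p - r)) • (t k p m j s * t k p i n r))]
  simp only [← Finset.sum_sub_distrib, ← smul_sub, hc, t_comm_succ, mul_comm (y ^ _)]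

/-- Reordering: the RTT relation is solved for `T(x) T(y)` when `(x - y) ^ 2 ≠ 1`. -/
theorem Tval_mul_Tval {x y : k} (h : (x - y) ^ 2 ≠ 1) (i j m n : Fin 2) :
    Tval k p x i j * Tval k p y m n = ((x - y) ^ 2 - 1)⁻¹ •
      ((x - y) ^ 2 • (Tval k p y m n * Tval k p x i j)
        - (x - y) • (Tval k p y m j * Tval k p x i n)
        + (x - y) • (Tval k p y i n * Tval k p x m j) - Tval k p y i j * Tval k p x m n) := by
  rw [eq_inv_smul_iff₀ (sub_ne_zero.2 h)]
  have h1 := Tval_comm (p := p) x y i j m n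
  have h2 := Tval_comm (p := p) x y m j i n
  linear_combination (norm := module) (x - y) • h1 + h2

/-! ### Centrality of the values of the quantum determinant -/

variable (k p) in
/-- The value at a scalar `x` of the quantum determinant `D(u)`. -/
noncomputable def qdetVal (x : k) : Yangian k p :=
  Tval k p x 0 0 * Tval k p (x - 1) 1 1 - Tval k p x 1 0 * Tval k p (x - 1) 0 1

/-- `D(x)` commutes with `T(y)`, for `y` outside the poles of the reordering formula. -/
theorem qdetVal_comm_Tval {x y : k} (h : (x - y) ^ 2 ≠ 1) (h' : (x - 1 - y) ^ 2 ≠ 1)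
    (m n : Fin 2) : Commute (qdetVal k p x) (Tval k p y m n) := by
  have hxx := fun i j m n => Tval_comm (p := p) x (x - 1) i j m n
  simp only [sub_sub_cancel, one_smul] at hxx
  -- At `y = x - 1` the RTT relation says that antisymmetrizing `T_{ij}(x) T_{mn}(x - 1)` in the row
  -- indices `i, m` gives `0` for `j = n` and `± D(x)` for `j ≠ n`.
  have r1 : Tval k p x 1 0 * Tval k p (x - 1) 0 0 = Tval k p x 0 0 * Tval k p (x - 1) 1 0 := by
    linear_combination (norm := module) -hxx 0 0 1 0
  have r2 : Tval k p x 1 1 * Tval k p (x - 1) 0 1 = Tval k p x 0 1 * Tval k p (x - 1) 1 1 := by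
    linear_combination (norm := module) -hxx 0 1 1 1
  have r3 : Tval k p x 1 1 * Tval k p (x - 1) 0 0 = Tval k p x 0 1 * Tval k p (x - 1) 1 0
      + Tval k p x 0 0 * Tval k p (x - 1) 1 1 - Tval k p x 1 0 * Tval k p (x - 1) 0 1 := by
    linear_combination (norm := module) -hxx 0 1 1 0 - hxx 0 0 1 1
  have e1' := fun i j m n z => congrArg (· * z) (Tval_mul_Tval (p := p) h i j m n)
  have e2 := fun i j m n => Tval_mul_Tval (p := p) h' i j m n
  simp only [mul_assoc] at e1'
  have a : (x - y) ^ 2 - 1 ≠ 0 := sub_ne_zero.2 h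
  have a' : (x - 1 - y) ^ 2 - 1 ≠ 0 := sub_ne_zero.2 h'
  rw [commute_iff_eq, qdetVal]
  -- Move `T(y)` to the left, then bring the products `T(x) T(x - 1)` into normal form by `r1`, `r2`
  -- and `r3`; both sides become the same combination of monomials.
  fin_cases m <;> fin_cases n <;>
  · simp only [Fin.zero_eta, Fin.mk_one, Fin.isValue, sub_mul, mul_sub, mul_assoc, e2,
      mul_smul_comm, smul_mul_assoc, mul_add, add_mul, e1', smul_add, smul_sub, smul_smul]
    simp only [mul_sub, mul_add, r1, r2, r3]
    match_scalars <;> field_simp <;> ring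

/-- `D(x)` is central for every scalar `x`. -/
theorem qdetVal_comm_t [Infinite k] (x : k) (m n : Fin 2) (r : ℕ) :
    Commute (qdetVal k p x) (t k p m n r) := by
  have h := map_t_eq_zero (p := p) (i := m) (j := n)
    (LinearMap.mulLeft k (qdetVal k p x) - LinearMap.mulRight k (qdetVal k p x))
    -- the solutions `y` of `(x - y) ^ 2 = 1` and of `(x - 1 - y) ^ 2 = 1`
    (F := {x - 1, x + 1, x - 2, x}) (Set.toFinite _) (fun y hy => ?_) r
  · rw [commute_iff_eq]
    simpa [sub_eq_zero] using h
  simp only [Set.mem_insert_iff, Set.mem_singleton_iff, not_or] at hy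
  obtain ⟨h1, h2, h3, h4⟩ := hy
  have hsq : ∀ z : k, z ^ 2 = 1 → z = 1 ∨ z = -1 := fun z hz =>
    sq_eq_sq_iff_eq_or_eq_neg.1 (hz.trans (one_pow 2).symm)
  have hc := qdetVal_comm_Tval (p := p) (x := x) (y := y)
    (fun h => by rcases hsq _ h with h | h <;> grind)
    (fun h => by rcases hsq _ h with h | h <;> grind) m n
  simpa [sub_eq_zero] using hc.eq

/-- The elements `t_{22}^{(r)}` commute with each other. -/
theorem t_one_one_comm [Infinite k] (r s : ℕ) :
    t k p 1 1 r * t k p 1 1 s = t k p 1 1 s * t k p 1 1 r := by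
  have hT : ∀ (x y : k), x - y ≠ 1 →
      Tval k p x 1 1 * Tval k p y 1 1 = Tval k p y 1 1 * Tval k p x 1 1 := fun x y hxy => by
    have h := Tval_comm (p := p) x y 1 1 1 1
    have h' : (x - y - 1) • (Tval k p x 1 1 * Tval k p y 1 1 - Tval k p y 1 1 * Tval k p x 1 1)
        = 0 := by
      linear_combination (norm := module) h
    exact sub_eq_zero.1 ((smul_eq_zero.1 h').resolve_left (sub_ne_zero.2 hxy))
  have h1 : ∀ x : k, Tval k p x 1 1 * t k p 1 1 s = t k p 1 1 s * Tval k p x 1 1 := fun x => by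
    have := map_t_eq_zero (p := p) (i := 1) (j := 1)
      (LinearMap.mulLeft k (Tval k p x 1 1) - LinearMap.mulRight k (Tval k p x 1 1))
      (F := {x - 1}) (Set.toFinite _) (fun y hy => ?_) s
    · simpa [sub_eq_zero] using this
    · have := hT x y fun h => hy (by rw [← h, sub_sub_cancel]; rfl)
      simpa [sub_eq_zero] using this
  have := map_t_eq_zero (p := p) (i := 1) (j := 1)
    (LinearMap.mulRight k (t k p 1 1 s) - LinearMap.mulLeft k (t k p 1 1 s))
    Set.finite_empty (fun x _ => by simpa [sub_eq_zero] using h1 x) r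
  simpa [sub_eq_zero] using this

/-! ### Evaluation at scalars -/

/-- Evaluation of polynomials over a `k`-algebra at a scalar `x`; it is multiplicative since
scalars are central. -/
noncomputable def evalScalar {U : Type*} [Ring U] [Algebra k U] (x : k) : U[X] →+* U :=
  Polynomial.eval₂RingHom' (RingHom.id U) (algebraMap k U x)
    fun a => (Algebra.commutes x a).symm

theorem evalScalar_eq_sum {U : Type*} [Ring U] [Algebra k U] (x : k) (f : U[X]) :
    evalScalar x f = ∑ i ∈ Finset.range (f.natDegree + 1), x ^ i • f.coeff i := by
  change Polynomial.eval₂ _ _ f = _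
  rw [Polynomial.eval₂_eq_sum_range]
  refine Finset.sum_congr rfl fun i _ => ?_
  rw [Algebra.smul_def, Algebra.commutes, map_pow]
  rfl

@[simp]
theorem evalScalar_X {U : Type*} [Ring U] [Algebra k U] (x : k) :
    evalScalar x (Polynomial.X : U[X]) = algebraMap k U x :=
  Polynomial.eval₂_X _ _

@[simp]
theorem evalScalar_C {U : Type*} [Ring U] [Algebra k U] (x : k) (a : U) :
    evalScalar x (Polynomial.C a) = a :=
  Polynomial.eval₂_C _ _

/-- The `r = 0` term of the sum is the leading term `δ_{ij} u^p`. -/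
theorem T_eq_sum (i j : Fin 2) : T k p i j =
    ∑ r ∈ Finset.range (p + 1), Polynomial.C (t k p i j r) * Polynomial.X ^ (p - r) := by
  rw [T, Finset.range_eq_Ico, Finset.sum_eq_sum_Ico_succ_bot (by lia), t_zero]
  congr 1
  split_ifs <;> simp

theorem Tshift_eq_sum (i j : Fin 2) : Tshift k p i j = ∑ r ∈ Finset.range (p + 1),
    Polynomial.C (t k p i j r) * (Polynomial.X - 1) ^ (p - r) := by
  simp only [Tshift, T_eq_sum, Polynomial.sum_comp, Polynomial.C_mul_comp, Polynomial.X_pow_comp]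

theorem evalScalar_T (x : k) (i j : Fin 2) : evalScalar x (T k p i j) = Tval k p x i j := by
  simp only [T_eq_sum, Tval, map_sum, map_mul, map_pow, evalScalar_X, evalScalar_C]
  simp only [← map_pow, ← Algebra.commutes, ← Algebra.smul_def]

theorem evalScalar_Tshift (x : k) (i j : Fin 2) :
    evalScalar x (Tshift k p i j) = Tval k p (x - 1) i j := by
  simp only [Tshift_eq_sum, Tval, map_sum, map_mul, map_pow, map_sub, map_one, evalScalar_X,
    evalScalar_C]
  simp only [← map_one (algebraMap k (Yangian k p)), ← map_sub, ← map_pow, ← Algebra.commutes,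
    ← Algebra.smul_def]

theorem evalScalar_qdet (x : k) : evalScalar x (qdet k p) = qdetVal k p x := by
  simp only [qdet, qdetVal, map_sub, map_mul, evalScalar_T, evalScalar_Tshift]

/-! ### Centrality of the coefficients of `D(u)` -/

theorem adjoin_t_eq_top :
    Algebra.adjoin k {x | ∃ i j r, x = t k p i j r} = ⊤ := by
  have hsurj : Function.Surjective (proj k p) := RingQuot.mkAlgHom_surjective k (Rel k p)
  rw [eq_top_iff, ← (AlgHom.range_eq_top _).2 hsurj, ← Algebra.map_top,
    ← FreeAlgebra.adjoin_range_ι, AlgHom.map_adjoin]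
  refine Algebra.adjoin_mono ?_
  rintro _ ⟨_, ⟨⟨i, j, r⟩, rfl⟩, rfl⟩
  exact ⟨i, j, r + 1, by simp [t, freeGen]⟩

/-- The coefficients of the quantum determinant are central. -/
theorem qdet_coeff_comm [Infinite k] (n : ℕ) (a : Yangian k p) :
    (qdet k p).coeff n * a = a * (qdet k p).coeff n := by
  have key : ∀ (i j : Fin 2) (r : ℕ), Commute (t k p i j r) ((qdet k p).coeff n) := by
    intro i j r
    by_cases hn : (qdet k p).natDegree < n
    · rw [Polynomial.coeff_eq_zero_of_natDegree_lt hn]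
      exact Commute.zero_right _
    have h := coeff_eq_zero_of_eval (k := k) (n := (qdet k p).natDegree + 1) (F := ∅)
      (a := fun m => t k p i j r * (qdet k p).coeff m - (qdet k p).coeff m * t k p i j r)
      Set.finite_empty (fun x _ => ?_) (show n < (qdet k p).natDegree + 1 by lia)
    · exact sub_eq_zero.1 h
    have hx := (qdetVal_comm_t (p := p) x i j r).eq
    rw [← evalScalar_qdet, evalScalar_eq_sum, Finset.sum_mul, Finset.mul_sum, eq_comm,
      ← sub_eq_zero, ← Finset.sum_sub_distrib] at hx
    simpa only [smul_sub, mul_smul_comm, smul_mul_assoc] using hx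
  have ha : a ∈ Algebra.adjoin k {x | ∃ i j r, x = t k p i j r} := by
    rw [adjoin_t_eq_top]
    exact Algebra.mem_top
  refine Algebra.adjoin_induction (fun x hx => ?_) (fun r => ?_) (fun x y _ _ hx hy => ?_)
    (fun x y _ _ hx hy => ?_) ha
  · obtain ⟨i, j, r, rfl⟩ := hx
    exact (key i j r).eq.symm
  · exact (Algebra.commutes r _).symm
  · rw [mul_add, add_mul, hx, hy]
  · rw [← mul_assoc, hx, mul_assoc, hy, mul_assoc]

/-! ### Generators of `Γ` and of the Yangian -/

variable (k p) in
/-- The defining generators of `Γ`. -/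
def gamGenerators : Set (Yangian k p) :=
  Set.range (fun n : ℕ => (qdet k p).coeff n) ∪ {x | ∃ r ∈ Finset.Icc 1 p, x = t k p 1 1 r}

variable (k p) in
/-- The off-diagonal elements `t_{12}^{(r)}` and `t_{21}^{(r)}`. -/
def offDiag : Set (Yangian k p) :=
  {x | ∃ i j : Fin 2, i ≠ j ∧ ∃ r ≤ p, x = t k p i j r}

theorem gamGenerators_finite : (gamGenerators k p).Finite := by
  refine Set.Finite.union ?_ ?_
  · refine ((Finset.range ((qdet k p).natDegree + 1)).finite_toSet.image
      (qdet k p).coeff |>.insert 0).subset ?_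
    rintro _ ⟨n, rfl⟩
    by_cases hn : (qdet k p).natDegree < n
    · exact Or.inl (Polynomial.coeff_eq_zero_of_natDegree_lt hn)
    · exact Or.inr ⟨n, by simpa using Nat.lt_succ_of_le (not_lt.1 hn), rfl⟩
  · refine ((Finset.Icc 1 p).finite_toSet.image (t k p 1 1)).subset ?_
    rintro _ ⟨r, hr, rfl⟩
    exact ⟨r, hr, rfl⟩

theorem offDiag_finite : (offDiag k p).Finite := by
  refine (Set.toFinite (Set.range fun z : Fin 2 × Fin 2 × Fin (p + 1) =>
    t k p z.1 z.2.1 z.2.2)).subset ?_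
  rintro _ ⟨i, j, _, r, hr, rfl⟩
  exact ⟨(i, j, ⟨r, by lia⟩), rfl⟩

theorem gamGenerators_comm [Infinite k] :
    ∀ x ∈ gamGenerators k p, ∀ y ∈ gamGenerators k p, x * y = y * x := by
  rintro _ (⟨n, rfl⟩ | ⟨r, _, rfl⟩) y (⟨m, rfl⟩ | ⟨s, _, rfl⟩)
  · exact qdet_coeff_comm _ _
  · exact qdet_coeff_comm _ _
  · exact (qdet_coeff_comm _ _).symm
  · exact t_one_one_comm r s

theorem t_one_one_mem (r : ℕ) : t k p 1 1 r ∈ Algebra.adjoin k (gamGenerators k p) := by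
  rcases Nat.eq_zero_or_pos r with rfl | hr
  · rw [t_zero, if_pos rfl]
    exact one_mem _
  by_cases hp : p < r
  · rw [t_eq_zero hp]
    exact zero_mem _
  · exact Algebra.subset_adjoin (Or.inr ⟨r, Finset.mem_Icc.2 ⟨hr, not_lt.1 hp⟩, rfl⟩)

/-- The coefficients of `T_{11}(u)` can be recovered from `D(u)`, because
`T_{11}(u) T_{22}(u-1) = D(u) + T_{21}(u) T_{12}(u-1)` and `T_{22}(u-1)` is monic. -/
theorem adjoin_gamGenerators_union_offDiag :
    Algebra.adjoin k (gamGenerators k p ∪ offDiag k p) = ⊤ := by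
  set A := Algebra.adjoin k (gamGenerators k p ∪ offDiag k p) with hA
  let S : Subring (Yangian k p) := A.toSubring
  have hoff : ∀ (i j : Fin 2), i ≠ j → ∀ r, t k p i j r ∈ A := fun i j hij r => by
    by_cases hr : p < r
    · rw [t_eq_zero hr]
      exact zero_mem _
    · exact Algebra.subset_adjoin (Or.inr ⟨i, j, hij, r, not_lt.1 hr, rfl⟩)
  have h11 : ∀ r, t k p 1 1 r ∈ A := fun r =>
    Algebra.adjoin_mono Set.subset_union_left (t_one_one_mem r)
  have hC : ∀ a ∈ A, Polynomial.C a ∈ Polynomial.liftsRing S.subtype := fun a ha => by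
    rw [← Polynomial.lifts_iff_liftsRing]
    exact Polynomial.C_mem_lifts S.subtype ⟨a, ha⟩
  have hX : (Polynomial.X : (Yangian k p)[X]) ∈ Polynomial.liftsRing S.subtype := by
    rw [← Polynomial.lifts_iff_liftsRing]
    exact Polynomial.X_mem_lifts S.subtype
  have hT : ∀ i j, (∀ r, t k p i j r ∈ A) → T k p i j ∈ Polynomial.liftsRing S.subtype :=
    fun i j h => by
      rw [T_eq_sum]
      exact sum_mem fun r _ => mul_mem (hC _ (h r)) (pow_mem hX _)
  have hTs : ∀ i j, (∀ r, t k p i j r ∈ A) → Tshift k p i j ∈ Polynomial.liftsRing S.subtype :=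
    fun i j h => by
      rw [Tshift_eq_sum]
      exact sum_mem fun r _ => mul_mem (hC _ (h r)) (pow_mem (sub_mem hX (one_mem _)) _)
  have hD : qdet k p ∈ Polynomial.liftsRing S.subtype := by
    rw [← Polynomial.lifts_iff_liftsRing, Polynomial.lifts_iff_coeff_lifts]
    exact fun n => ⟨⟨_, Algebra.subset_adjoin (Or.inl (Or.inl ⟨n, rfl⟩))⟩, rfl⟩
  have hmonic : (Tshift k p 1 1).Monic := by
    have : (T k p 1 1).Monic := by
      rw [T, if_pos rfl]
      refine Polynomial.monic_X_pow_add (Polynomial.mem_degreeLT.1 (sum_mem fun r hr => ?_))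
      rw [Finset.mem_Icc] at hr
      exact Polynomial.mem_degreeLT.2 ((Polynomial.degree_C_mul_X_pow_le _ _).trans_lt
        (Nat.cast_lt.2 (by lia)))
    simpa [Tshift] using this.comp_X_sub_C 1
  have h00 : T k p 0 0 ∈ Polynomial.liftsRing S.subtype := by
    refine coeff_mem_of_mul_monic S hmonic (hTs 1 1 h11) _ ?_
    rw [← sub_add_cancel (T k p 0 0 * Tshift k p 1 1) (T k p 1 0 * Tshift k p 0 1)]
    exact add_mem hD (mul_mem (hT _ _ (hoff 1 0 (by decide))) (hTs _ _ (hoff 0 1 (by decide))))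
  have h00' : ∀ r, t k p 0 0 r ∈ A := fun r => by
    by_cases hr : p < r
    · rw [t_eq_zero hr]
      exact zero_mem _
    rw [← Polynomial.lifts_iff_liftsRing, Polynomial.lifts_iff_coeff_lifts] at h00
    obtain ⟨z, hz⟩ := h00 (p - r)
    have : (T k p 0 0).coeff (p - r) = t k p 0 0 r := by
      rw [T_eq_sum, Polynomial.finsetSum_coeff, Finset.sum_eq_single r]
      · simp
      · intro s hs hsr
        rw [Finset.mem_range] at hs
        rw [Polynomial.coeff_C_mul_X_pow, if_neg (by lia)]
      · intro h
        exact absurd (Finset.mem_range.2 (by lia)) h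
    rw [← this, ← hz]
    exact z.2
  rw [eq_top_iff, ← adjoin_t_eq_top]
  refine Algebra.adjoin_le ?_
  rintro _ ⟨i, j, r, rfl⟩
  by_cases hij : i = j
  · subst hij
    fin_cases i
    · exact h00' r
    · exact h11 r
  · exact hoff i j hij r

/-! ### Bimodules generated by the off-diagonal elements -/

/-- The left `Γ`-span of the off-diagonal elements is stable under right multiplication by the
generators of `Γ`: the commutator of `t_{12}^{(r)}` or `t_{21}^{(r)}` with `t_{22}^{(s)}` is a
combination of off-diagonal elements with coefficients `t_{22}^{(a)}`, and these stand on the left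
or on the right according to which of the two elements comes first in the commutator. -/
theorem offDiag_mul_mem [Infinite k] : ∀ w ∈ offDiag k p, ∀ c ∈ gamGenerators k p,
    w * c ∈ Submodule.span (Algebra.adjoin k (gamGenerators k p)) (offDiag k p) := by
  have hmul : ∀ c ∈ Algebra.adjoin k (gamGenerators k p), ∀ i j : Fin 2, i ≠ j → ∀ r,
      c * t k p i j r ∈ Submodule.span (Algebra.adjoin k (gamGenerators k p)) (offDiag k p) := by
    intro c hc i j hij r
    by_cases hr : p < r
    · rw [t_eq_zero hr, mul_zero]
      exact zero_mem _
    · exact Submodule.smul_mem _ (⟨c, hc⟩ : Algebra.adjoin k (gamGenerators k p))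
        (Submodule.subset_span ⟨i, j, hij, r, not_lt.1 hr, rfl⟩)
  rintro _ ⟨i, j, hij, r, -, rfl⟩ c hc
  rcases id hc with ⟨n, rfl⟩ | ⟨s, -, rfl⟩
  · rw [← qdet_coeff_comm]
    exact hmul _ (Algebra.subset_adjoin hc) _ _ hij _
  have h1 := fun s => t_one_one_mem (k := k) (p := p) s
  fin_cases i <;> fin_cases j
  · exact absurd rfl hij
  · rw [← sub_add_cancel (t k p _ _ r * t k p 1 1 s) (t k p 1 1 s * t k p _ _ r), t_comm]
    exact add_mem (sum_mem fun a _ => sub_mem (hmul _ (h1 _) _ _ hij _) (hmul _ (h1 _) _ _ hij _))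
      (hmul _ (h1 _) _ _ hij _)
  · rw [← sub_sub_cancel (t k p 1 1 s * t k p _ _ r) (t k p _ _ r * t k p 1 1 s), t_comm]
    exact sub_mem (hmul _ (h1 _) _ _ hij _)
      (sum_mem fun a _ => sub_mem (hmul _ (h1 _) _ _ hij _) (hmul _ (h1 _) _ _ hij _))
  · exact absurd rfl hij

/-- The right `Γ`-span of the off-diagonal elements is stable under left multiplication by the
generators of `Γ`. -/
theorem mul_offDiag_mem [Infinite k] : ∀ w ∈ offDiag k p, ∀ c ∈ gamGenerators k p,
    c * w ∈ Submodule.span (Algebra.adjoin k (gamGenerators k p)).op (offDiag k p) := by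
  have hmul : ∀ c ∈ Algebra.adjoin k (gamGenerators k p), ∀ i j : Fin 2, i ≠ j → ∀ r,
      t k p i j r * c ∈
        Submodule.span (Algebra.adjoin k (gamGenerators k p)).op (offDiag k p) := by
    intro c hc i j hij r
    by_cases hr : p < r
    · rw [t_eq_zero hr, zero_mul]
      exact zero_mem _
    · exact Submodule.smul_mem _
        (⟨MulOpposite.op c, hc⟩ : (Algebra.adjoin k (gamGenerators k p)).op)
        (Submodule.subset_span ⟨i, j, hij, r, not_lt.1 hr, rfl⟩)
  rintro _ ⟨i, j, hij, r, -, rfl⟩ c hc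
  rcases id hc with ⟨n, rfl⟩ | ⟨s, -, rfl⟩
  · rw [qdet_coeff_comm]
    exact hmul _ (Algebra.subset_adjoin hc) _ _ hij _
  have h1 := fun s => t_one_one_mem (k := k) (p := p) s
  fin_cases i <;> fin_cases j
  · exact absurd rfl hij
  · rw [← sub_add_cancel (t k p 1 1 s * t k p _ _ r) (t k p _ _ r * t k p 1 1 s), t_comm]
    exact add_mem (sum_mem fun a _ => sub_mem (hmul _ (h1 _) _ _ hij _) (hmul _ (h1 _) _ _ hij _))
      (hmul _ (h1 _) _ _ hij _)
  · rw [← sub_sub_cancel (t k p _ _ r * t k p 1 1 s) (t k p 1 1 s * t k p _ _ r), t_comm]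
    exact sub_mem (hmul _ (h1 _) _ _ hij _)
      (sum_mem fun a _ => sub_mem (hmul _ (h1 _) _ _ hij _) (hmul _ (h1 _) _ _ hij _))
  · exact absurd rfl hij

end LevelYangian

theorem theorem4 (k : Type*) [Field k] [IsAlgClosed k] [CharZero k] (p : ℕ) (hp : 0 < p) :
    IsHarishChandraSubalgebra (LevelYangian.Gam k p) :=
  IsHarishChandraSubalgebra.of_adjoin LevelYangian.gamGenerators_finite
    LevelYangian.gamGenerators_comm LevelYangian.offDiag_finite
    LevelYangian.adjoin_gamGenerators_union_offDiag
    LevelYangian.offDiag_mul_mem LevelYangian.mul_offDiag_mem
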